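/- Let $L^2,L^\infty$ be the usual spaces on the unit circle $\mathbb T$ (with normalised arc-length measure), $H^2\subset L^2$ the Hardy space (functions with vanishing negative Fourier coefficients), $H^\infty=L^\infty\cap H^2$, $P_+$ the orthogonal projection of $L^2$ onto $H^2$, and $P_-=I-P_+$. For $H=\begin{bmatrix} f&u\\ g&v\end{bmatrix}$ with entries in $L^\infty$, the generalized Cauchy singular integral operator (GSIO) $R_H$ on $L^2$ is $$R_Hx=P_+fP_+x+P_-gP_+x+P_+uP_-x+P_-vP_-x .$$ Write $h_-=P_-h$ and $Vh=\bar z\bar h$ for $h\in L^2$, and $(p\otimes q)(x)=\langle x,q\rangle p$. Let $H_j=\begin{bmatrix} f_j&u_j\\ g_j&v_j\end{bmatrix}$, $j=1,2$, have entries in $L^\infty$, and consider the equation between operators on $L^2\oplus L^2$ $$\begin{aligned}&\begin{pmatrix}V(\bar f_1)_-\\ g_{1-}\end{pmatrix}\otimes\begin{pmatrix}Vf_{2-}\\ (\bar u_2)_-\end{pmatrix}-\begin{pmatrix}V(\bar u_1)_-\\ v_{1-}\end{pmatrix}\otimes\begin{pmatrix}Vg_{2-}\\ (\bar v_2)_-\end{pmatrix}\\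 =\;&\begin{pmatrix}V(\bar f_2)_-\\ g_{2-}\end{pmatrix}\otimes\begin{pmatrix}Vf_{1-}\\ (\bar u_1)_-\end{pmatrix}-\begin{pmatrix}V(\bar u_2)_-\\ v_{2-}\end{pmatrix}\otimes\begin{pmatrix}Vg_{1-}\\ (\bar v_1)_-\end{pmatrix}.\end{aligned}\tag{WW}$$ **Theorem.** If both sides of (WW) are zero, then $R_{H_1}R_{H_2}=R_{H_2}R_{H_1}$ if and only if at least one of the following statements holds. - $(1)$ $\bar f_1,\bar f_2,g_1,g_2,\bar u_1,\bar u_2,v_1,v_2\in H^\infty$. - $(2)$ $\bar f_1,\bar f_2,g_1,g_2,\bar u_2,(\bar f_2-\bar v_2)\bar u_1\in H^\infty$, and $v_2$ is constant. - $(\hat 2)$ $\bar f_1,\bar f_2,g_1,g_2,\bar u_1,(\bar f_1-\bar v_1)\bar u_2\in H^\infty$, and $v_1$ is constant. - $(3)$ $g_2,\bar u_1,\bar u_2,v_1,v_2,(f_2-v_2)g_1\in H^\infty$, and $f_2$ is constant. - $(\hat 3)$ $g_1,\bar u_1,\bar u_2,v_1,v_2,(f_1-v_1)g_2\in H^\infty$,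 and $f_1$ is constant. - $(4)$ $g_2,\bar u_2,(\bar f_2-\bar v_2)\bar u_1,(f_2-v_2)g_1\in H^\infty$, and $f_2$ and $v_2$ are constant. - $(\hat 4)$ $g_1,\bar u_1,(\bar f_1-\bar v_1)\bar u_2,(f_1-v_1)g_2\in H^\infty$, and $f_1$ and $v_1$ are constant. - $(5)$ $\bar f_1,\bar f_2,g_1,g_2,\bar v_1,\bar v_2,(\bar f_1-\bar v_1)\bar u_2-(\bar f_2-\bar v_2)\bar u_1\in H^\infty$. - $(6)$ $g_1,g_2,\bar u_1,\bar u_2\in H^\infty$, and $f_2$ and $v_1$ are constant. - $(\hat 6)$ $g_1,g_2,\bar u_1,\bar u_2\in H^\infty$, and $f_1$ and $v_2$ are constant. - $(7)$ $g_1,g_2,\bar u_2,\bar v_1,\bar v_2,(\bar f_2-\bar v_2)\bar u_1\in H^\infty$, and $f_2$ is constant. - $(\hat 7)$ $g_1,g_2,\bar u_1,\bar v_1,\bar v_2,(\bar f_1-\bar v_1)\bar u_2\in H^\infty$, and $f_1$ is constant. - $(8)$ There is a non-zero constant $\lambda$ such that $g_1,g_2,\bar f_1-\bar\lambda\bar u_1,\bar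 v_2-\bar\lambda\bar u_2,\bar f_1\bar f_2+\bar v_1\bar v_2-\bar f_1\bar v_2\in H^\infty$, and $f_2$ and $v_1$ are constant. - $(\hat 8)$ There is a non-zero constant $\mu$ such that $g_1,g_2,\bar f_2-\bar\mu\bar u_2,\bar v_1-\bar\mu\bar u_1,\bar f_1\bar f_2+\bar v_1\bar v_2-\bar f_2\bar v_1\in H^\infty$, and $f_1$ and $v_2$ are constant. - $(9)$ $f_1,f_2,\bar u_1,\bar u_2,v_1,v_2,(f_2-v_2)g_1-(f_1-v_1)g_2\in H^\infty$. - $(10)$ $f_1,f_2,g_2,\bar u_1,\bar u_2,(f_2-v_2)g_1\in H^\infty$, and $v_2$ is constant. - $(\hat{10})$ $f_1,f_2,g_1,\bar u_1,\bar u_2,(f_1-v_1)g_2\in H^\infty$, and $v_1$ is constant. - $(11)$ There is a non-zero constant $\lambda$ such that $\bar u_1,\bar u_2,g_1-\lambda v_1,g_2-\lambda f_2,f_1f_2+v_1v_2-v_1f_2\in H^\infty$, and $f_1$ and $v_2$ are constant. - $(\hat{11})$ There is a non-zero constant $\mu$ such that $\bar u_1,\bar u_2,g_2-\mu v_2,g_1-\mu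 f_1,f_1f_2+v_1v_2-v_2f_1\in H^\infty$, and $f_2$ and $v_1$ are constant. - $(12)$ $f_1,f_2,g_1,g_2,\bar u_1,\bar u_2,\bar v_1,\bar v_2\in H^\infty$. - $(13)$ There are non-zero constants $\lambda$ and $\mu$ such that $\bar f_1-\bar\lambda\bar u_1,\ g_1-\lambda v_1,\ g_2-\lambda f_2,\ \bar v_2-\bar\lambda\bar u_2,\ \bar f_2-\bar\mu\bar u_2,\ g_2-\mu v_2,\ g_1-\mu f_1,\ \bar v_1-\bar\mu\bar u_1\in H^\infty$, and $\lambda f_2v_1-\mu f_1v_2$ is constant. -/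

import Mathlib

open MeasureTheory AddCircle
open scoped ENNReal

noncomputable section

namespace GCSI

instance factTwoPiPos : Fact (0 < 2 * Real.pi) := ⟨Real.two_pi_pos⟩

/-- The unit circle, parametrised by `x ↦ exp (i x)`, `x ∈ ℝ / 2πℤ`. Under this identification
`fourier n` is the function `z ↦ z ^ n`. -/
abbrev Torus : Type := AddCircle (2 * Real.pi)

/-- Normalised arc-length measure on the circle. -/
abbrev arc : Measure Torus := haarAddCircle

/-- The Hilbert space `L²` of the circle. -/
abbrev L2 : Type := Lp ℂ 2 arc

/-- The space `L^∞` of the circle. -/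
abbrev LInf : Type := Lp ℂ ∞ arc

/-- The (almost everywhere) pointwise product on `L^∞`. -/
instance instMulLInf : Mul LInf :=
  ⟨fun f g => (ContinuousLinearMap.mul ℂ ℂ).holder ∞ f g⟩

/-- The multiplication operator `M_f x = f x` on `L²`, for `f ∈ L^∞`. -/
def mulOp (f : LInf) : L2 →L[ℂ] L2 :=
  (ContinuousLinearMap.mul ℂ ℂ).holderL arc ∞ 2 2 f

/-- The inclusion `L^∞ ⊆ L²`. -/
def toL2 : LInf →ₗ[ℂ] L2 where
  toFun f := ((Lp.memLp f).mono_exponent (p := 2) le_top).toLp f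
  map_add' f g := by
    rw [← MemLp.toLp_add]
    exact MemLp.toLp_congr _ _ (Lp.coeFn_add f g)
  map_smul' c f := by
    rw [RingHom.id_apply, ← MemLp.toLp_const_smul]
    exact MemLp.toLp_congr _ _ (Lp.coeFn_smul c f)

/-- The Hardy space `H²`: the functions in `L²` whose negative Fourier coefficients vanish. -/
def H2 : Submodule ℂ L2 where
  carrier := {f | ∀ n : ℤ, n < 0 → fourierCoeff f n = 0}
  add_mem' {f g} hf hg n hn := by
    have h1 := hf n hn
    have h2 := hg n hn
    rw [← fourierBasis_repr] at h1 h2 ⊢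
    simp [h1, h2]
  zero_mem' n _ := by
    rw [← fourierBasis_repr]
    simp
  smul_mem' c f hf n hn := by
    have h1 := hf n hn
    rw [← fourierBasis_repr] at h1 ⊢
    simp [h1]

theorem isClosed_H2 : IsClosed (H2 : Set L2) := by
  have h : (H2 : Set L2) = ⋂ n : ℤ, ⋂ _ : n < 0, {f : L2 | inner ℂ (fourierBasis n : L2) f = 0} := by
    ext f
    simp only [Set.mem_iInter, Set.mem_ofPred_eq, ← HilbertBasis.repr_apply_apply,
      fourierBasis_repr]
    rfl
  rw [h]
  exact isClosed_iInter fun n => isClosed_iInter fun _ =>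
    isClosed_eq (continuous_const.inner continuous_id) continuous_const

instance completeSpaceH2 : CompleteSpace H2 := isClosed_H2.completeSpace_coe

/-- `H^∞ = L^∞ ∩ H²`. -/
def HInf : Submodule ℂ LInf := H2.comap toL2

/-- `f ∈ L^∞` is (almost everywhere) a constant function. -/
def IsConst (f : LInf) : Prop := ∃ c : ℂ, f = Lp.const ∞ arc c

/-- The Riesz projection `P₊`: the orthogonal projection of `L²` onto `H²`. -/
def Pplus : L2 →L[ℂ] L2 := H2.starProjection

/-- `P₋ = I - P₊`. -/
def Pminus : L2 →L[ℂ] L2 := 1 - Pplus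

/-- The generalized Cauchy singular integral operator
`R_H = P₊ f P₊ + P₋ g P₊ + P₊ u P₋ + P₋ v P₋` with symbol `H = [f, u; g, v]`. -/
def gsio (H : Matrix (Fin 2) (Fin 2) LInf) : L2 →L[ℂ] L2 :=
  Pplus ∘L mulOp (H 0 0) ∘L Pplus + Pminus ∘L mulOp (H 1 0) ∘L Pplus
    + Pplus ∘L mulOp (H 0 1) ∘L Pminus + Pminus ∘L mulOp (H 1 1) ∘L Pminus

/-- The anti-unitary operator `V x = z̄ x̄` on `L²`. -/
def V (x : L2) : L2 := mulOp (fourierLp ∞ (-1)) (star x)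

/-- `f₋ = P₋ f` for `f ∈ L^∞ ⊆ L²`. -/
def neg (f : LInf) : L2 := Pminus (toL2 f)

/-- The column vector with entries `p`, `q`, in the Hilbert space `L² ⊕ L²`. -/
def col (p q : L2) : WithLp 2 (L2 × L2) := WithLp.toLp 2 (p, q)

/-- With `H₁ = [f₁, u₁; g₁, v₁]` and `H₂ = [f₂, u₂; g₂, v₂]`, the operator
`(V (f̄₁)₋, (g₁)₋) ⊗ (V (f₂)₋, (ū₂)₋) - (V (ū₁)₋, (v₁)₋) ⊗ (V (g₂)₋, (v̄₂)₋)` on `L² ⊕ L²`,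
where `p ⊗ q` is the operator `x ↦ ⟨x, q⟩ p` (the inner product being linear in `x`). -/
def tensorSide (H₁ H₂ : Matrix (Fin 2) (Fin 2) LInf) :
    WithLp 2 (L2 × L2) →L[ℂ] WithLp 2 (L2 × L2) :=
  InnerProductSpace.rankOne ℂ
      (col (V (neg (star (H₁ 0 0)))) (neg (H₁ 1 0)))
      (col (V (neg (H₂ 0 0))) (neg (star (H₂ 0 1))))
    - InnerProductSpace.rankOne ℂ
      (col (V (neg (star (H₁ 0 1)))) (neg (H₁ 1 1)))
      (col (V (neg (H₂ 1 0))) (neg (star (H₂ 1 1))))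

end GCSI

end

open GCSI

/-!
With respect to the exponential basis, the product of two singular integral operators splits into
four blocks, and each block is a corner of an operator `a P₊ b + c P₋ d`, where `a, b, c, d` are
entries of the two symbols. Moving one step down a diagonal changes the matrix entry of such an
operator by a rank-one term (`entry_add_one`), and these terms are exactly the Fourier coefficients
of one side of the operator equation. So if both sides vanish, all blocks of both products are
constant along diagonals.

On a diagonal block the constant value is the limit along the diagonal, a Fourier coefficient of
the product of two diagonal symbol entries (`entry_diag`), which is symmetric in the two operators:
the diagonal blocks always commute. On an off-diagonal block the value can be read off at the
boundary of the block, and commutation becomes an identity between Fourier coefficients of one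
sign: `upCross f₁ v₁ u₂ = upCross f₂ v₂ u₁` for positive ones and its mirror image for `downCross`
for negative ones. Reflection `n ↦ -1 - n` exchanges `P₊` and `P₋`, so one computation serves both
(`entry_reflect`). This gives `gsio_comm_iff_cross`.

The vanishing of one side of the operator equation says that two rank-one kernels agree. Hence
either two of the four factors vanish, in one of four patterns, or the factors are proportional
(`tensorSide_cases`). The two sides give 25 combinations. In four of them the proportional pattern
contradicts the vanishing pattern of the other side; in each of the other 21 the two cross
identities simplify to the remaining conditions of one of the listed statements, a different one
each time, by the formulas `upCross_eq_zero`, `upCross_eq`, `smul_upCross_sub_of_const`,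
`smul_upCross_sub` and their mirror images. The same formulas show that each listed statement
implies the cross identities.
-/

open GCSI

noncomputable section

namespace GCSI

/-! ### Convolution and truncation of square-summable sequences -/

/-- Square-summable sequences indexed by `ℤ`, the home of the Fourier coefficients of `L²`. -/
abbrev Seq : Type := lp (fun _ : ℤ => ℂ) 2

theorem Seq.summable_sq (x : Seq) : Summable fun n => ‖x n‖ ^ 2 := by
  have h := (memℓp_gen_iff (by norm_num)).1 (lp.memℓp x)
  simpa using h

theorem memℓp_two_of_summable {x : ℤ → ℂ} (h : Summable fun n => ‖x n‖ ^ 2) :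
    Memℓp x 2 := memℓp_gen (by simpa using h)

/-- Truncation of a sequence to the indices in `s`. -/
def trunc (s : Set ℤ) : Seq →ₗ[ℂ] Seq where
  toFun x := ⟨s.indicator x, memℓp_two_of_summable <| x.summable_sq.of_nonneg_of_le
    (fun _ => by positivity) fun n => by
      gcongr
      exact norm_indicator_le_norm_self _ _⟩
  map_add' x y := by
    ext n
    exact congrFun (Set.indicator_add s x y) n
  map_smul' c x := by
    ext n
    by_cases h : n ∈ s <;> simp [h]

@[simp] theorem trunc_apply (s : Set ℤ) (x : Seq) (n : ℤ) : trunc s x n = s.indicator x n := rfl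

/-- Reflection `n ↦ -n` of the index. -/
def rev : Seq →ₗ[ℂ] Seq where
  toFun x := ⟨fun n => x (-n), memℓp_two_of_summable <|
    (Equiv.neg ℤ).summable_iff.2 x.summable_sq⟩
  map_add' _ _ := rfl
  map_smul' _ _ := rfl

@[simp] theorem rev_apply (x : Seq) (n : ℤ) : rev x n = x (-n) := rfl

@[simp] theorem rev_rev (x : Seq) : rev (rev x) = x := by
  ext n
  simp

theorem summable_conv (x y : Seq) (m : ℤ) : Summable fun n => x (m - n) * y n := by
  refine .of_norm_bounded (((Equiv.subLeft m).summable_iff.2 x.summable_sq).add y.summable_sq)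
    fun n => ?_
  rw [norm_mul]
  simp only [Function.comp_apply, Equiv.subLeft_apply]
  nlinarith [sq_nonneg (‖x (m - n)‖ - ‖y n‖), sq_nonneg ‖x (m - n)‖, sq_nonneg ‖y n‖]

/-- Convolution of two square-summable sequences. -/
def conv : Seq →ₗ[ℂ] Seq →ₗ[ℂ] (ℤ → ℂ) :=
  LinearMap.mk₂ ℂ (fun x y m => ∑' n, x (m - n) * y n)
    (fun x x' y => by
      ext m
      simp only [lp.coeFn_add, Pi.add_apply, add_mul]
      exact (summable_conv x y m).tsum_add (summable_conv x' y m))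
    (fun c x y => by
      ext m
      simp only [lp.coeFn_smul, Pi.smul_apply, smul_eq_mul, mul_assoc]
      exact tsum_mul_left)
    (fun x y y' => by
      ext m
      simp only [lp.coeFn_add, Pi.add_apply, mul_add]
      exact (summable_conv x y m).tsum_add (summable_conv x y' m))
    (fun c x y => by
      ext m
      simp only [lp.coeFn_smul, Pi.smul_apply, smul_eq_mul, mul_left_comm _ c]
      exact tsum_mul_left)

theorem conv_apply (x y : Seq) (m : ℤ) : conv x y m = ∑' n, x (m - n) * y n := rfl

theorem conv_comm (x y : Seq) : conv x y = conv y x := by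
  ext m
  rw [conv_apply, conv_apply, ← (Equiv.subLeft m).tsum_eq]
  refine tsum_congr fun n => ?_
  simp [mul_comm]

theorem conv_rev (x y : Seq) (m : ℤ) : conv (rev x) (rev y) m = conv x y (-m) := by
  rw [conv_apply, conv_apply, ← (Equiv.neg ℤ).tsum_eq]
  refine tsum_congr fun n => ?_
  simp only [rev_apply, Equiv.neg_apply, neg_neg]
  congr 2
  ring_nf

/-! ### Matrix entries of the blocks of a product -/

/-- The entry `(j, k)` of the matrix of `a P₊ b + c P₋ d`, in the exponential basis, where
`a, b, c, d` are given by their Fourier coefficients. -/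
def entry (a b c d : Seq) (j k : ℤ) : ℂ :=
  conv a (trunc {n | -k ≤ n} b) (j - k) + conv c (trunc {n | n < -k} d) (j - k)

/-- Exchanging the half-lines `n ≥ 0` and `n < 0` by `n ↦ -1 - n` exchanges `P₊` and `P₋`. -/
theorem entry_reflect (a b c d : Seq) (j k : ℤ) :
    entry a b c d (-1 - j) (-1 - k) = entry (rev c) (rev d) (rev a) (rev b) j k := by
  have h1 : trunc {n | -k ≤ n} (rev d) = rev (trunc {n | n < -(-1 - k)} d) := by
    ext n
    simp only [trunc_apply, rev_apply, Set.indicator_apply, Set.mem_ofPred_eq]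
    exact if_congr (by omega) rfl rfl
  have h2 : trunc {n | n < -k} (rev b) = rev (trunc {n | -(-1 - k) ≤ n} b) := by
    ext n
    simp only [trunc_apply, rev_apply, Set.indicator_apply, Set.mem_ofPred_eq]
    exact if_congr (by omega) rfl rfl
  rw [entry, entry, h1, h2, conv_rev, conv_rev, add_comm,
    show -1 - j - (-1 - k) = -(j - k) by ring]

/-- One step down the diagonal moves a single index from the half-line of `P₋` to that of `P₊`. -/
theorem entry_add_one (a b c d : Seq) (j k : ℤ) :
    entry a b c d (j + 1) (k + 1)
      = entry a b c d j k + (a (j + 1) * b (-(k + 1)) - c (j + 1) * d (-(k + 1))) := by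
  have key : ∀ x y : Seq, conv x (trunc {-(k + 1)} y) (j - k) = x (j + 1) * y (-(k + 1)) := by
    intro x y
    rw [conv_apply, tsum_eq_single (-(k + 1))]
    · simp only [trunc_apply, Set.mem_singleton_iff, Set.indicator_of_mem]
      congr 2
      ring_nf
    · intro n hn
      rw [trunc_apply, Set.indicator_of_notMem (by simpa using hn), mul_zero]
  have h1 : trunc {n | -(k + 1) ≤ n} b = trunc {n | -k ≤ n} b + trunc {-(k + 1)} b := by
    ext n
    simp only [trunc_apply, Set.indicator_apply, Set.mem_ofPred_eq, lp.coeFn_add, Pi.add_apply,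
      Set.mem_singleton_iff]
    split_ifs <;> first | omega | simp
  have h2 : trunc {n | n < -k} d = trunc {n | n < -(k + 1)} d + trunc {-(k + 1)} d := by
    ext n
    simp only [trunc_apply, Set.indicator_apply, Set.mem_ofPred_eq, lp.coeFn_add, Pi.add_apply,
      Set.mem_singleton_iff]
    split_ifs <;> first | omega | simp
  rw [entry, entry, show j + 1 - (k + 1) = j - k by ring, h1, h2, map_add, map_add, Pi.add_apply,
    Pi.add_apply, key, key]
  ring

/-- Far down a diagonal, `a P₊ b + c P₋ d` looks like multiplication by `a b`. -/
theorem tendsto_entry (a b c d : Seq) (j k : ℤ) :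
    Filter.Tendsto (fun N : ℕ => entry a b c d (j + N) (k + N)) Filter.atTop
      (nhds (conv a b (j - k))) := by
  have hlim : ∀ (x y z : Seq) (s : ℕ → Set ℤ)
      (_ : ∀ n, ∀ᶠ N in Filter.atTop, (s N).indicator y n = z n),
      Filter.Tendsto (fun N : ℕ => conv x (trunc (s N) y) (j - k)) Filter.atTop
        (nhds (conv x z (j - k))) := by
    intro x y z s hs
    refine tendsto_tsum_of_dominated_convergence (summable_conv x y (j - k)).norm (fun n => ?_)
      (Filter.Eventually.of_forall fun N n => ?_)
    · refine Filter.Tendsto.congr' ?_ tendsto_const_nhds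
      filter_upwards [hs n] with N hN
      rw [trunc_apply, hN]
    · rw [norm_mul, norm_mul]
      gcongr
      exact norm_indicator_le_norm_self _ _
  have h1 := hlim a b b (fun N => {n | -(k + N) ≤ n}) fun n => by
    filter_upwards [Filter.eventually_ge_atTop (-k - n).toNat] with N hN
    exact Set.indicator_of_mem (by simp only [Set.mem_ofPred_eq]; omega) _
  have h2 := hlim c d 0 (fun N => {n | n < -(k + N)}) fun n => by
    filter_upwards [Filter.eventually_ge_atTop (-k - n).toNat] with N hN
    exact Set.indicator_of_notMem (by simp only [Set.mem_ofPred_eq]; omega) _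
  simpa [entry] using h1.add h2

/-! ### Positive Fourier coefficients -/

/-- The coefficients of positive index. -/
def pos : Seq →ₗ[ℂ] (ℕ → ℂ) where
  toFun x n := x (n + 1)
  map_add' _ _ := rfl
  map_smul' _ _ := rfl

/-- The part of a sequence supported on the positive indices. -/
def posPart : Seq →ₗ[ℂ] Seq := trunc {n | 0 < n}

/-- The coefficients of positive index of the convolution. -/
def posConv : Seq →ₗ[ℂ] Seq →ₗ[ℂ] (ℕ → ℂ) :=
  conv.compr₂ (LinearMap.funLeft ℂ ℂ fun n : ℕ => (n + 1 : ℤ))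

theorem posConv_apply (x y : Seq) (n : ℕ) : posConv x y n = conv x y (n + 1) := rfl

theorem posConv_comm (x y : Seq) : posConv x y = posConv y x := by
  ext n
  rw [posConv_apply, posConv_apply, conv_comm]

theorem posPart_congr {x y : Seq} (h : pos x = pos y) : posPart x = posPart y := by
  ext n
  simp only [posPart, trunc_apply, Set.indicator_apply, Set.mem_ofPred_eq]
  split_ifs with hn
  · obtain ⟨m, rfl⟩ : ∃ m : ℕ, n = m + 1 := ⟨(n - 1).toNat, by omega⟩
    exact congrFun h m
  · rfl

theorem posPart_eq_zero {x : Seq} (h : pos x = 0) : posPart x = 0 := by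
  rw [posPart_congr (y := 0) (by rw [h, map_zero]), map_zero]

@[simp] theorem pos_posPart (x : Seq) : pos (posPart x) = pos x := by
  ext n
  exact Set.indicator_of_mem (by simp only [Set.mem_ofPred_eq]; omega) _

/-- Sequences without positive coefficients are closed under convolution. -/
theorem posConv_eq_zero {x y : Seq} (hx : pos x = 0) (hy : pos y = 0) : posConv x y = 0 := by
  have h0 : ∀ {z : Seq}, pos z = 0 → ∀ n : ℤ, 0 < n → z n = 0 := by
    intro z hz n hn
    obtain ⟨m, rfl⟩ : ∃ m : ℕ, n = m + 1 := ⟨(n - 1).toNat, by omega⟩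
    exact congrFun hz m
  ext m
  rw [posConv_apply, conv_apply, Pi.zero_apply]
  refine (tsum_congr fun n => ?_).trans tsum_zero
  rcases lt_or_ge 0 n with hn | hn
  · rw [h0 hy n hn, mul_zero]
  · rw [h0 hx _ (by omega), zero_mul]

/-- If `x` has no positive coefficients, only the positive part of `y` contributes to the positive
coefficients of the product. -/
theorem posConv_posPart {x : Seq} (hx : pos x = 0) (y : Seq) :
    posConv x (posPart y) = posConv x y := by
  have h : posConv x (y - posPart y) = 0 := posConv_eq_zero hx (by simp)
  rw [map_sub, sub_eq_zero] at h
  exact h.symm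

/-! ### Commutation of the blocks -/

/-- The positive coefficients of `(f - f⁺ - v) u⁺`, the symbol that decides whether the
off-diagonal blocks commute. -/
def cross (f v u : Seq) : ℕ → ℂ := posConv (f - posPart f - v) (posPart u)

theorem entry_toeplitz {a b c d : Seq} {j k : ℤ}
    (h : a (j + 1) * b (-(k + 1)) = c (j + 1) * d (-(k + 1))) :
    entry a b c d (j + 1) (k + 1) = entry a b c d j k := by
  rw [entry_add_one, h, sub_self, add_zero]

/-- On a block with constant diagonals, each entry equals the limit along its diagonal. -/
theorem entry_diag {a b c d : Seq}
    (h : ∀ i k : ℕ, a (i + 1) * b (-(k + 1)) = c (i + 1) * d (-(k + 1)))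
    (j k : ℕ) : entry a b c d j k = conv a b (j - k) := by
  have hN : ∀ N : ℕ, entry a b c d (j + N) (k + N) = entry a b c d j k := by
    intro N
    induction N with
    | zero => simp
    | succ N ih =>
      have := entry_toeplitz (h (j + N) (k + N))
      push_cast at this ⊢
      rw [← add_assoc, ← add_assoc, this, ih]
  have h1 := tendsto_entry a b c d j k
  simp only [hN] at h1
  exact tendsto_nhds_unique tendsto_const_nhds h1

/-- A block with constant diagonals, for rows `j ≥ 0` and columns `k < 0`, is determined by its row
`j = 0`. -/
theorem entry_offDiag {a b c d : Seq}
    (h : ∀ i k : ℕ, a (i + 1) * b (k + 1) = c (i + 1) * d (k + 1))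
    (j k : ℕ) : entry a b c d j (-(k + 1)) = entry a b c d 0 (-(j + k + 1)) := by
  induction j generalizing k with
  | zero => simp
  | succ j ih =>
    have h1 := entry_toeplitz (a := a) (b := b) (c := c) (d := d) (j := j) (k := -(k + 2))
      (by rw [show -(-((k : ℤ) + 2) + 1) = k + 1 by ring]; exact h j k)
    rw [show -((k : ℤ) + 2) + 1 = -(k + 1) by ring] at h1
    have h2 := ih (k + 1)
    push_cast at h2 ⊢
    rw [h1, show (k : ℤ) + 2 = k + 1 + 1 by ring, h2]
    congr 1
    ring

theorem entry_zero_left (a b c d : Seq) (m : ℕ) :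
    entry a b c d 0 (-(m + 1)) = posConv (a - posPart a) b m + posConv (posPart c) d m := by
  rw [entry, posConv_apply, posConv_apply]
  simp only [sub_neg_eq_add, zero_add, neg_neg]
  congr 1 <;> rw [conv_apply, conv_apply] <;> refine tsum_congr fun n => ?_
  · simp only [posPart, trunc_apply, Set.indicator_apply, Set.mem_ofPred_eq, lp.coeFn_sub,
      Pi.sub_apply]
    split_ifs <;> first | omega | simp
  · simp only [posPart, trunc_apply, Set.indicator_apply, Set.mem_ofPred_eq]
    split_ifs <;> first | omega | simp

theorem offDiag_comm_iff_cross (f₁ u₁ v₁ f₂ u₂ v₂ : Seq) :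
    (∀ m : ℕ, entry f₁ u₂ u₁ v₂ 0 (-(m + 1)) = entry f₂ u₁ u₂ v₁ 0 (-(m + 1))) ↔
      cross f₁ v₁ u₂ = cross f₂ v₂ u₁ := by
  have h : ∀ f v u : Seq, cross f v u = posConv (f - posPart f) u - posConv (posPart u) v := by
    intro f v u
    rw [cross, map_sub posConv _ v, LinearMap.sub_apply, posConv_posPart (by simp),
      posConv_comm v]
  simp only [entry_zero_left]
  rw [h, h, funext_iff]
  refine forall_congr' fun m => ?_
  simp only [Pi.sub_apply]
  constructor <;> intro e <;> linear_combination e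

/-- If the blocks mapping into `H²` have constant diagonals, their agreement for the two orders of
multiplication amounts to one identity between cross symbols. -/
theorem entries_comm_iff_cross {f₁ u₁ g₁ v₁ f₂ u₂ g₂ v₂ : Seq}
    (h1 : ∀ i k : ℕ, f₁ (i + 1) * f₂ (-(k + 1)) = u₁ (i + 1) * g₂ (-(k + 1)))
    (h2 : ∀ i k : ℕ, f₂ (i + 1) * f₁ (-(k + 1)) = u₂ (i + 1) * g₁ (-(k + 1)))
    (h3 : ∀ i k : ℕ, f₁ (i + 1) * u₂ (k + 1) = u₁ (i + 1) * v₂ (k + 1))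
    (h4 : ∀ i k : ℕ, f₂ (i + 1) * u₁ (k + 1) = u₂ (i + 1) * v₁ (k + 1)) :
    ((∀ j k : ℕ, entry f₁ f₂ u₁ g₂ j k = entry f₂ f₁ u₂ g₁ j k) ∧
      ∀ j k : ℕ, entry f₁ u₂ u₁ v₂ j (-(k + 1)) = entry f₂ u₁ u₂ v₁ j (-(k + 1))) ↔
      cross f₁ v₁ u₂ = cross f₂ v₂ u₁ := by
  rw [← offDiag_comm_iff_cross]
  constructor
  · rintro ⟨-, h⟩ m
    exact_mod_cast h 0 m
  · intro h
    refine ⟨fun j k => ?_, fun j k => ?_⟩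
    · rw [entry_diag h1, entry_diag h2, conv_comm]
    · rw [entry_offDiag h3, entry_offDiag h4]
      exact_mod_cast h (j + k)

/-! ### Evaluation of the cross symbol -/

theorem cross_eq_zero {f v u : Seq} (hu : pos u = 0) : cross f v u = 0 := by
  rw [cross, posPart_eq_zero hu, map_zero]

theorem cross_eq_posConv {f v : Seq} (hf : pos f = 0) (hv : pos v = 0) (u : Seq) :
    cross f v u = posConv (f - v) u := by
  rw [cross, posPart_eq_zero hf, sub_zero, posConv_posPart (by rw [map_sub, hf, hv, sub_zero])]

theorem smul_cross {f v u w : Seq} {c : ℂ} (h : pos w = c • pos u) :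
    c • cross f v u = cross f v w := by
  rw [cross, cross, ← map_smul, ← map_smul,
    posPart_congr (x := c • u) (y := w) (by rw [map_smul, h])]

/-- Each positive coefficient of `f v` comes from a positive coefficient of `f` or one of `v`. -/
theorem posConv_split (f v : Seq) :
    posConv (f - posPart f) (posPart v) + posConv v (posPart f) = posConv f v := by
  rw [posConv_posPart (by simp), map_sub, LinearMap.sub_apply, posConv_comm v]
  abel

/-- When `f₁`, `u₁` and `v₂`, `u₂` are proportional at positive frequencies, the cross identity
becomes a condition on products of the diagonal entries alone. -/
theorem smul_cross_sub_of_const {f₁ u₁ v₁ f₂ u₂ v₂ : Seq} {l : ℂ} (hf : pos f₁ = l • pos u₁)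
    (hv : pos v₂ = l • pos u₂) (hf₂ : pos f₂ = 0) (hv₁ : pos v₁ = 0) :
    l • (cross f₁ v₁ u₂ - cross f₂ v₂ u₁)
      = -(posConv f₁ f₂ + posConv v₁ v₂ - posConv f₁ v₂) := by
  rw [smul_sub, smul_cross hv, smul_cross hf, cross, cross, posPart_eq_zero hf₂, sub_zero,
    map_sub posConv _ v₁, map_sub posConv f₂, LinearMap.sub_apply, LinearMap.sub_apply,
    posConv_posPart hf₂, posConv_posPart hv₁, ← posConv_split f₁ v₂, posConv_comm f₂]
  abel

theorem smul_cross_sub {f₁ u₁ v₁ f₂ u₂ v₂ : Seq} {l m : ℂ} (hf₁ : pos f₁ = l • pos u₁)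
    (hv₂ : pos v₂ = l • pos u₂) (hf₂ : pos f₂ = m • pos u₂) (hv₁ : pos v₁ = m • pos u₁) :
    (l * m) • (cross f₁ v₁ u₂ - cross f₂ v₂ u₁)
      = -(l • posConv f₂ v₁ - m • posConv f₁ v₂) := by
  have h1 : (l * m) • cross f₁ v₁ u₂
      = m • posConv (f₁ - posPart f₁) (posPart v₂) - l • posConv v₁ (posPart f₂) := by
    rw [cross, map_sub posConv _ v₁, LinearMap.sub_apply,
      posPart_congr (x := v₂) (y := l • u₂) (by rw [map_smul, hv₂]),
      posPart_congr (x := f₂) (y := m • u₂) (by rw [map_smul, hf₂])]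
    simp only [map_smul, smul_sub, smul_smul, mul_comm l m]
  have h2 : (l * m) • cross f₂ v₂ u₁
      = l • posConv (f₂ - posPart f₂) (posPart v₁) - m • posConv v₂ (posPart f₁) := by
    rw [cross, map_sub posConv _ v₂, LinearMap.sub_apply,
      posPart_congr (x := v₁) (y := m • u₁) (by rw [map_smul, hv₁]),
      posPart_congr (x := f₁) (y := l • u₁) (by rw [map_smul, hf₁])]
    simp only [map_smul, smul_sub, smul_smul, mul_comm l m]
  rw [smul_sub, h1, h2, ← posConv_split f₂ v₁, ← posConv_split f₁ v₂, smul_add, smul_add]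
  abel

/-! ### Fourier coefficients -/

/-- The Fourier transform `L² ≃ ℓ²(ℤ)`. -/
def hat : L2 ≃ₗᵢ[ℂ] Seq := fourierBasis.repr

/-- The Fourier coefficients of a bounded function. -/
def coef : LInf →ₗ[ℂ] Seq := hat.toLinearEquiv.toLinearMap ∘ₗ toL2

theorem coef_eq_hat (f : LInf) : coef f = hat (toL2 f) := rfl

theorem hat_eq_integral (x : L2) (n : ℤ) :
    hat x n = ∫ t, fourier (-n) t * x t ∂arc := by
  rw [hat, fourierBasis_repr]
  rfl

theorem toL2_coeFn (f : LInf) : toL2 f =ᵐ[arc] f := MemLp.coeFn_toLp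
    ((Lp.memLp f).mono_exponent (p := 2) le_top)

theorem mulOp_coeFn (f : LInf) (x : L2) : mulOp f x =ᵐ[arc] fun t => f t * x t :=
  (ContinuousLinearMap.mul ℂ ℂ).coeFn_holder (r := 2) f x

theorem mul_coeFn (f g : LInf) : ⇑(f * g) =ᵐ[arc] fun t => f t * g t :=
  (ContinuousLinearMap.mul ℂ ℂ).coeFn_holder (r := ∞) f g

theorem toL2_injective : Function.Injective toL2 := by
  intro f g h
  refine Lp.ext ?_
  filter_upwards [toL2_coeFn f, toL2_coeFn g] with t h1 h2
  rw [← h1, ← h2, h]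

theorem coef_injective : Function.Injective coef := hat.injective.comp toL2_injective

/-- The exponential `z ↦ z ^ k` in `L²`. -/
abbrev expo (k : ℤ) : L2 := fourierLp 2 k

theorem hat_expo (k n : ℤ) : hat (expo k) n = if n = k then 1 else 0 := by
  classical
  have h : expo k = fourierBasis k := by rw [coe_fourierBasis]
  rw [h, hat, HilbertBasis.repr_self, lp.single_apply, Pi.single_apply]

theorem hat_mulOp_expo (f : LInf) (k n : ℤ) : hat (mulOp f (expo k)) n = coef f (n - k) := by
  rw [coef_eq_hat, hat_eq_integral, hat_eq_integral]
  refine integral_congr_ae ?_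
  filter_upwards [mulOp_coeFn f (expo k), toL2_coeFn f, coeFn_fourierLp 2 k] with t h1 h2 h3
  rw [h1, h2, h3, show -(n - k) = -n + k by ring, fourier_add]
  ring

/-- Multiplication by a bounded function is convolution of Fourier coefficients. -/
theorem hat_mulOp (f : LInf) (x : L2) (n : ℤ) : hat (mulOp f x) n = conv (coef f) (hat x) n := by
  have h1 : HasSum (fun k => hat x k • expo k) x := by
    have := fourierBasis.hasSum_repr x
    rwa [coe_fourierBasis] at this
  have h2 : HasSum (fun k => hat (mulOp f (hat x k • expo k)) n) (hat (mulOp f x) n) := by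
    have := h1.mapL ((innerSL ℂ (expo n)).comp (mulOp f))
    have e : ∀ y : L2, ((innerSL ℂ (expo n)).comp (mulOp f)) y = hat (mulOp f y) n := by
      intro y
      rw [hat, HilbertBasis.repr_apply_apply, coe_fourierBasis]
      rfl
    simpa only [e] using this
  rw [← h2.tsum_eq, conv_apply]
  refine tsum_congr fun k => ?_
  rw [map_smul, map_smul, lp.coeFn_smul, Pi.smul_apply, hat_mulOp_expo, smul_eq_mul, mul_comm]

theorem coef_mul (f g : LInf) (n : ℤ) : coef (f * g) n = conv (coef f) (coef g) n := by
  have h : toL2 (f * g) = mulOp f (toL2 g) := by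
    refine Lp.ext ?_
    filter_upwards [toL2_coeFn (f * g), toL2_coeFn g, mulOp_coeFn f (toL2 g), mul_coeFn f g]
      with t h1 h2 h3 h4
    rw [h1, h3, h2, h4]
  rw [coef_eq_hat, h, hat_mulOp]
  rfl

theorem hat_star (x : L2) (n : ℤ) : hat (star x) n = star (hat x (-n)) := by
  rw [hat_eq_integral, hat_eq_integral]
  change _ = (starRingEnd ℂ) _
  rw [← integral_conj]
  refine integral_congr_ae ?_
  filter_upwards [Lp.coeFn_star x] with t h
  rw [h, map_mul, ← fourier_neg, neg_neg]
  rfl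

theorem toL2_star (f : LInf) : toL2 (star f) = star (toL2 f) := by
  refine Lp.ext ?_
  filter_upwards [toL2_coeFn f, toL2_coeFn (star f), Lp.coeFn_star f, Lp.coeFn_star (toL2 f)]
    with t h1 h2 h3 h4
  rw [h2, h3, h4, Pi.star_apply, Pi.star_apply, h1]

theorem coef_star (f : LInf) (n : ℤ) : coef (star f) n = star (coef f (-n)) := by
  rw [coef_eq_hat, toL2_star, hat_star]
  rfl

/-! The instances on `L^∞` carry no star ring structure, so the rules for `star` and for the product
are stated one by one. -/

theorem LInf.star_sub (f g : LInf) : star (f - g) = star f - star g := by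
  apply coef_injective
  ext n
  rw [map_sub, lp.coeFn_sub, Pi.sub_apply]
  simp only [coef_star, map_sub, lp.coeFn_sub, Pi.sub_apply, _root_.star_sub]

theorem LInf.star_add (f g : LInf) : star (f + g) = star f + star g := by
  apply coef_injective
  ext n
  rw [map_add, lp.coeFn_add, Pi.add_apply]
  simp only [coef_star, map_add, lp.coeFn_add, Pi.add_apply, StarAddMonoid.star_add]

theorem LInf.star_smul (c : ℂ) (f : LInf) : star (c • f) = star c • star f := by
  apply coef_injective
  ext n
  rw [map_smul, lp.coeFn_smul, Pi.smul_apply]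
  simp only [coef_star, map_smul, lp.coeFn_smul, Pi.smul_apply, smul_eq_mul, star_mul']

theorem LInf.star_mul (f g : LInf) : star (f * g) = star f * star g := by
  refine Lp.ext ?_
  filter_upwards [Lp.coeFn_star (f * g), Lp.coeFn_star f, Lp.coeFn_star g, mul_coeFn f g,
    mul_coeFn (star f) (star g)] with t h1 h2 h3 h4 h5
  rw [h1, h5, h2, h3, Pi.star_apply, h4, Pi.star_apply, Pi.star_apply, star_mul']

theorem LInf.mul_comm (f g : LInf) : f * g = g * f := by
  refine Lp.ext ?_
  filter_upwards [mul_coeFn f g, mul_coeFn g f] with t h1 h2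
  rw [h1, h2, _root_.mul_comm]

/-! ### Membership in `H^∞` and constancy through Fourier coefficients -/

/-- The Fourier coefficients of positive index, `n ↦ f̂(n + 1)`. -/
def up : LInf →ₗ[ℂ] (ℕ → ℂ) := pos ∘ₗ coef

/-- The Fourier coefficients of negative index, `n ↦ f̂(-(n + 1))`. -/
def down : LInf →ₗ[ℂ] (ℕ → ℂ) := pos ∘ₗ rev ∘ₗ coef

theorem up_apply (f : LInf) (n : ℕ) : up f n = coef f (n + 1) := rfl

theorem down_apply (f : LInf) (n : ℕ) : down f n = coef f (-(n + 1)) := rfl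

theorem mem_HInf_iff (f : LInf) : f ∈ HInf ↔ down f = 0 := by
  have h : f ∈ HInf ↔ ∀ n : ℤ, n < 0 → coef f n = 0 := by
    simp only [coef_eq_hat, hat, fourierBasis_repr]
    rfl
  rw [h, funext_iff]
  constructor
  · intro h n
    exact h _ (by omega)
  · intro h n hn
    obtain ⟨m, rfl⟩ : ∃ m : ℕ, n = -(m + 1) := ⟨(-n - 1).toNat, by omega⟩
    exact h m

theorem star_mem_HInf_iff (f : LInf) : star f ∈ HInf ↔ up f = 0 := by
  rw [mem_HInf_iff, funext_iff, funext_iff]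
  refine forall_congr' fun n => ?_
  rw [down_apply, up_apply, coef_star, neg_neg, Pi.zero_apply, star_eq_zero]

theorem coef_const (c : ℂ) (n : ℤ) : coef (Lp.const ∞ arc c) n = if n = 0 then c else 0 := by
  have h : toL2 (Lp.const ∞ arc c) = c • expo 0 := by
    refine Lp.ext ?_
    filter_upwards [toL2_coeFn (Lp.const ∞ arc c), Lp.coeFn_const ∞ arc c,
      Lp.coeFn_smul c (expo 0), coeFn_fourierLp 2 0] with t h1 h2 h3 h4
    rw [h1, h2, h3, Pi.smul_apply, h4]
    simp
  rw [coef_eq_hat, h, map_smul, lp.coeFn_smul, Pi.smul_apply, hat_expo]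
  simp

theorem isConst_iff (f : LInf) : IsConst f ↔ up f = 0 ∧ down f = 0 := by
  constructor
  · rintro ⟨c, rfl⟩
    constructor <;> ext n
    · rw [up_apply, coef_const, if_neg (by omega), Pi.zero_apply]
    · rw [down_apply, coef_const, if_neg (by omega), Pi.zero_apply]
  · rintro ⟨h1, h2⟩
    refine ⟨coef f 0, coef_injective ?_⟩
    ext n
    rw [coef_const]
    split_ifs with hn
    · rw [hn]
    · rcases lt_or_gt_of_ne hn with hn | hn
      · obtain ⟨m, rfl⟩ : ∃ m : ℕ, n = -(m + 1) := ⟨(-n - 1).toNat, by omega⟩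
        exact congrFun h2 m
      · obtain ⟨m, rfl⟩ : ∃ m : ℕ, n = m + 1 := ⟨(n - 1).toNat, by omega⟩
        exact congrFun h1 m

theorem up_mul (f g : LInf) : up (f * g) = posConv (coef f) (coef g) := by
  ext n
  rw [up_apply, coef_mul, posConv_apply]

theorem down_mul (f g : LInf) : down (f * g) = posConv (rev (coef f)) (rev (coef g)) := by
  ext n
  rw [down_apply, coef_mul, posConv_apply, conv_rev]

/-! ### Matrix entries of the operators -/

theorem hat_Pplus (x : L2) : hat (Pplus x) = trunc {n | 0 ≤ n} (hat x) := by
  suffices h : Pplus x = hat.symm (trunc {n | 0 ≤ n} (hat x)) by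
    rw [h, LinearIsometryEquiv.apply_symm_apply]
  refine Submodule.eq_starProjection_of_mem_of_inner_eq_zero (K := H2) ?_ ?_
  · intro n hn
    rw [← fourierBasis_repr]
    change hat (hat.symm _) n = 0
    rw [LinearIsometryEquiv.apply_symm_apply, trunc_apply]
    exact Set.indicator_of_notMem (by simpa using hn) _
  · intro w hw
    rw [← hat.inner_map_map, map_sub, LinearIsometryEquiv.apply_symm_apply, lp.inner_eq_tsum]
    refine (tsum_congr fun n => ?_).trans tsum_zero
    rcases lt_or_ge n 0 with hn | hn
    · have : hat w n = 0 := by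
        rw [hat, fourierBasis_repr]
        exact hw n hn
      rw [this, inner_zero_right]
    · rw [lp.coeFn_sub, Pi.sub_apply, trunc_apply, Set.indicator_of_mem (by simpa using hn),
        sub_self, inner_zero_left]

theorem hat_Pminus (x : L2) : hat (Pminus x) = trunc {n | n < 0} (hat x) := by
  rw [Pminus, _root_.sub_apply, one_apply_eq_self, map_sub, hat_Pplus]
  ext n
  simp only [lp.coeFn_sub, Pi.sub_apply, trunc_apply, Set.indicator_apply, Set.mem_ofPred_eq]
  split_ifs <;> first | omega | simp

theorem hat_gsio (f u g v : LInf) (x : L2) (j : ℤ) :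
    hat (gsio !![f, u; g, v] x) j
      = conv (coef (if 0 ≤ j then f else g)) (trunc {n | 0 ≤ n} (hat x)) j
        + conv (coef (if 0 ≤ j then u else v)) (trunc {n | n < 0} (hat x)) j := by
  have h : gsio !![f, u; g, v] x
      = Pplus (mulOp f (Pplus x)) + Pminus (mulOp g (Pplus x))
        + Pplus (mulOp u (Pminus x)) + Pminus (mulOp v (Pminus x)) := rfl
  rw [h]
  simp only [map_add, hat_Pplus, hat_Pminus, lp.coeFn_add, Pi.add_apply, trunc_apply,
    Set.indicator_apply, Set.mem_ofPred_eq, hat_mulOp]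
  split_ifs <;> first | omega | simp

theorem hat_gsio_expo (f u g v : LInf) (j k : ℤ) :
    hat (gsio !![f, u; g, v] (expo k)) j
      = coef (if 0 ≤ k then (if 0 ≤ j then f else g) else (if 0 ≤ j then u else v)) (j - k) := by
  rw [hat_gsio, conv_apply, conv_apply, tsum_eq_single k, tsum_eq_single k]
  · simp only [trunc_apply, Set.indicator_apply, Set.mem_ofPred_eq, hat_expo]
    split_ifs <;> first | omega | simp
  all_goals
    intro n hn
    simp [Set.indicator_apply, hat_expo, hn]

/-- The matrix entry `(j, k)` of a product of two singular integral operators. -/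
theorem hat_gsio_gsio (f₁ u₁ g₁ v₁ f₂ u₂ g₂ v₂ : LInf) (j k : ℤ) :
    hat (gsio !![f₁, u₁; g₁, v₁] (gsio !![f₂, u₂; g₂, v₂] (expo k))) j
      = entry (coef (if 0 ≤ j then f₁ else g₁)) (coef (if 0 ≤ k then f₂ else u₂))
          (coef (if 0 ≤ j then u₁ else v₁)) (coef (if 0 ≤ k then g₂ else v₂)) j k := by
  rw [hat_gsio, entry]
  congr 1 <;> rw [conv_apply, conv_apply, ← (Equiv.addRight k).tsum_eq] <;>
    refine tsum_congr fun n => ?_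
  all_goals
    simp only [Equiv.coe_addRight, trunc_apply, Set.indicator_apply, Set.mem_ofPred_eq,
      hat_gsio_expo, add_sub_cancel_right]
    rw [show j - (n + k) = j - k - n by ring]
    congr 1
    split_ifs <;> first | omega | rfl

theorem gsio_comm_iff (f₁ u₁ g₁ v₁ f₂ u₂ g₂ v₂ : LInf) :
    gsio !![f₁, u₁; g₁, v₁] ∘L gsio !![f₂, u₂; g₂, v₂]
        = gsio !![f₂, u₂; g₂, v₂] ∘L gsio !![f₁, u₁; g₁, v₁] ↔
      ∀ j k, hat (gsio !![f₁, u₁; g₁, v₁] (gsio !![f₂, u₂; g₂, v₂] (expo k))) j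
        = hat (gsio !![f₂, u₂; g₂, v₂] (gsio !![f₁, u₁; g₁, v₁] (expo k))) j := by
  constructor
  · intro h j k
    have := congrArg (fun T : L2 →L[ℂ] L2 => hat (T (expo k)) j) h
    exact this
  · intro h
    refine ContinuousLinearMap.ext_on (s := Set.range expo)
      (Submodule.dense_iff_topologicalClosure_eq_top.2
        (span_fourierLp_closure_eq_top ENNReal.ofNat_ne_top)) ?_
    rintro _ ⟨k, rfl⟩
    apply hat.injective
    ext j
    exact h j k

/-! ### The rank-one identity -/

/-- `V` reflects frequencies by `n ↦ -1 - n`, so it maps the range of `P₋` into `H²`. -/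
theorem hat_V (x : L2) (n : ℤ) : hat (V x) n = star (hat x (-(n + 1))) := by
  rw [V, hat_eq_integral, ← hat_star, hat_eq_integral]
  refine integral_congr_ae ?_
  filter_upwards [mulOp_coeFn (fourierLp ∞ (-1)) (star x),
    coeFn_fourierLp (T := 2 * Real.pi) ∞ (-1)] with t h1 h2
  rw [h1, h2, neg_add, fourier_add]
  ring

theorem hat_neg (f : LInf) : hat (neg f) = trunc {n | n < 0} (coef f) := hat_Pminus _

theorem inner_expo (x : L2) (k : ℤ) : inner ℂ x (expo k) = star (hat x k) := by
  rw [hat, HilbertBasis.repr_apply_apply, coe_fourierBasis]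
  exact (inner_conj_symm _ _).symm

theorem hat_neg_nat (f : LInf) (n : ℕ) : hat (neg f) (-(n + 1)) = down f n := by
  rw [hat_neg, trunc_apply, Set.indicator_of_mem (by simp only [Set.mem_ofPred_eq]; omega),
    down_apply]

theorem down_star (f : LInf) (n : ℕ) : down (star f) n = star (up f n) := by
  rw [down_apply, coef_star, neg_neg, up_apply]

/-- Vanishing of one side of the operator equation, read off on Fourier coefficients. -/
theorem tensorSide_eq_zero {f₁ u₁ g₁ v₁ f₂ u₂ g₂ v₂ : LInf}
    (h : tensorSide !![f₁, u₁; g₁, v₁] !![f₂, u₂; g₂, v₂] = 0) (i k : ℕ) :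
    up f₁ i * down f₂ k = up u₁ i * down g₂ k ∧ up f₁ i * up u₂ k = up u₁ i * up v₂ k ∧
      down g₁ i * down f₂ k = down v₁ i * down g₂ k ∧
        down g₁ i * up u₂ k = down v₁ i * up v₂ k := by
  have key : ∀ x y : L2,
      (inner ℂ (V (neg f₂)) x + inner ℂ (neg (star u₂)) y) • col (V (neg (star f₁))) (neg g₁)
        = (inner ℂ (V (neg g₂)) x + inner ℂ (neg (star v₂)) y)
          • col (V (neg (star u₁))) (neg v₁) := by
    intro x y
    have := congrArg (fun T : WithLp 2 (L2 × L2) →L[ℂ] WithLp 2 (L2 × L2) => T (col x y)) h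
    exact sub_eq_zero.1 this
  have keyfst : ∀ x y : L2, _ := fun x y =>
    congrArg (fun z : WithLp 2 (L2 × L2) => hat z.fst i) (key x y)
  have keysnd : ∀ x y : L2, _ := fun x y =>
    congrArg (fun z : WithLp 2 (L2 × L2) => hat z.snd (-(i + 1))) (key x y)
  have e1 := keyfst (expo k) 0
  have e2 := keyfst 0 (expo (-(k + 1)))
  have e3 := keysnd (expo k) 0
  have e4 := keysnd 0 (expo (-(k + 1)))
  simp only [col, WithLp.toLp_fst, WithLp.toLp_snd, WithLp.smul_fst, WithLp.smul_snd, map_smul,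
    lp.coeFn_smul, Pi.smul_apply,
    inner_zero_right, inner_expo, hat_V, hat_neg_nat, down_star, star_star, smul_eq_mul,
    add_zero, zero_add] at e1 e2 e3 e4
  exact ⟨by linear_combination e1, by linear_combination e2, by linear_combination e3,
    by linear_combination e4⟩

/-! ### Commutation in terms of cross symbols -/

/-- The positive Fourier coefficients of `(f - f⁺ - v) u⁺`, where `h⁺` keeps the Fourier
coefficients of positive index of `h`. -/
def upCross (f v u : LInf) : ℕ → ℂ := cross (coef f) (coef v) (coef u)

/-- The negative Fourier coefficients of `(v - v₋ - f) g₋`. -/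
def downCross (f v g : LInf) : ℕ → ℂ := cross (rev (coef v)) (rev (coef f)) (rev (coef g))

theorem upCross_eq_zero {f v u : LInf} (hu : up u = 0) : upCross f v u = 0 := cross_eq_zero hu

theorem downCross_eq_zero {f v g : LInf} (hg : down g = 0) : downCross f v g = 0 :=
  cross_eq_zero hg

theorem upCross_eq {f v : LInf} (hf : up f = 0) (hv : up v = 0) (u : LInf) :
    upCross f v u = up ((f - v) * u) := by
  rw [upCross, cross_eq_posConv hf hv, up_mul, map_sub coef]

theorem downCross_eq {f v : LInf} (hf : down f = 0) (hv : down v = 0) (g : LInf) :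
    downCross f v g = -down ((f - v) * g) := by
  rw [downCross, cross_eq_posConv hv hf, down_mul, map_sub coef, map_sub rev,
    ← neg_sub (rev (coef f)), map_neg, LinearMap.neg_apply]

theorem smul_upCross_sub_of_const {f₁ u₁ v₁ f₂ u₂ v₂ : LInf} {l : ℂ} (hf : up f₁ = l • up u₁)
    (hv : up v₂ = l • up u₂) (hf₂ : up f₂ = 0) (hv₁ : up v₁ = 0) :
    l • (upCross f₁ v₁ u₂ - upCross f₂ v₂ u₁) = -up (f₁ * f₂ + v₁ * v₂ - f₁ * v₂) := by
  rw [map_sub, map_add, up_mul, up_mul, up_mul]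
  exact smul_cross_sub_of_const hf hv hf₂ hv₁

theorem smul_downCross_sub_of_const {f₁ g₁ v₁ f₂ g₂ v₂ : LInf} {l : ℂ} (hl : l ≠ 0)
    (hg₁ : down g₁ = l • down v₁) (hg₂ : down g₂ = l • down f₂) (hv₂ : down v₂ = 0)
    (hf₁ : down f₁ = 0) :
    l⁻¹ • (downCross f₁ v₁ g₂ - downCross f₂ v₂ g₁) = -down (f₁ * f₂ + v₁ * v₂ - v₁ * f₂) := by
  rw [map_sub, map_add, down_mul, down_mul, down_mul, add_comm]
  exact smul_cross_sub_of_const ((eq_inv_smul_iff₀ hl).2 hg₁.symm)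
    ((eq_inv_smul_iff₀ hl).2 hg₂.symm) hv₂ hf₁

theorem smul_upCross_sub {f₁ u₁ v₁ f₂ u₂ v₂ : LInf} {l m : ℂ} (hf₁ : up f₁ = l • up u₁)
    (hv₂ : up v₂ = l • up u₂) (hf₂ : up f₂ = m • up u₂) (hv₁ : up v₁ = m • up u₁) :
    (l * m) • (upCross f₁ v₁ u₂ - upCross f₂ v₂ u₁)
      = -up (l • (f₂ * v₁) - m • (f₁ * v₂)) := by
  rw [map_sub, map_smul, map_smul, up_mul, up_mul]
  exact smul_cross_sub hf₁ hv₂ hf₂ hv₁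

theorem downCross_sub {f₁ g₁ v₁ f₂ g₂ v₂ : LInf} {l m : ℂ} (hl : l ≠ 0) (hm : m ≠ 0)
    (h1 : down g₁ = l • down v₁) (h2 : down g₂ = l • down f₂)
    (h3 : down g₂ = m • down v₂) (h4 : down g₁ = m • down f₁) :
    downCross f₁ v₁ g₂ - downCross f₂ v₂ g₁ = down (l • (f₂ * v₁) - m • (f₁ * v₂)) := by
  have h : (l⁻¹ * m⁻¹) • (downCross f₁ v₁ g₂ - downCross f₂ v₂ g₁)
      = -(l⁻¹ • posConv (rev (coef v₂)) (rev (coef f₁))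
        - m⁻¹ • posConv (rev (coef v₁)) (rev (coef f₂))) :=
    smul_cross_sub ((eq_inv_smul_iff₀ hl).2 h1.symm) ((eq_inv_smul_iff₀ hl).2 h2.symm)
      ((eq_inv_smul_iff₀ hm).2 h3.symm) ((eq_inv_smul_iff₀ hm).2 h4.symm)
  rw [posConv_comm, ← down_mul, posConv_comm, ← down_mul] at h
  rw [map_sub, map_smul, map_smul]
  ext n
  have hn := congrFun h n
  simp only [Pi.smul_apply, Pi.sub_apply, Pi.neg_apply, smul_eq_mul] at hn ⊢
  field_simp at hn
  linear_combination hn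

/-- When both sides of the operator equation vanish, the blocks of both products have constant
diagonals, and commutation reduces to two identities between cross symbols. -/
theorem gsio_comm_iff_cross {f₁ u₁ g₁ v₁ f₂ u₂ g₂ v₂ : LInf}
    (hleft : tensorSide !![f₁, u₁; g₁, v₁] !![f₂, u₂; g₂, v₂] = 0)
    (hright : tensorSide !![f₂, u₂; g₂, v₂] !![f₁, u₁; g₁, v₁] = 0) :
    gsio !![f₁, u₁; g₁, v₁] ∘L gsio !![f₂, u₂; g₂, v₂]
        = gsio !![f₂, u₂; g₂, v₂] ∘L gsio !![f₁, u₁; g₁, v₁] ↔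
      upCross f₁ v₁ u₂ = upCross f₂ v₂ u₁ ∧ downCross f₁ v₁ g₂ = downCross f₂ v₂ g₁ := by
  have hl := tensorSide_eq_zero hleft
  have hr := tensorSide_eq_zero hright
  have hup := entries_comm_iff_cross (f₁ := coef f₁) (u₁ := coef u₁) (g₁ := coef g₁)
    (v₁ := coef v₁) (f₂ := coef f₂) (u₂ := coef u₂) (g₂ := coef g₂) (v₂ := coef v₂)
    (fun i k => (hl i k).1) (fun i k => (hr i k).1) (fun i k => (hl i k).2.1)
    (fun i k => (hr i k).2.1)
  have hrev : ∀ (x : Seq) (n : ℕ), rev x (-(n + 1)) = x (n + 1) := fun x n => by simp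
  have hdown := entries_comm_iff_cross (f₁ := rev (coef v₁)) (u₁ := rev (coef g₁))
    (g₁ := rev (coef u₁)) (v₁ := rev (coef f₁)) (f₂ := rev (coef v₂)) (u₂ := rev (coef g₂))
    (g₂ := rev (coef u₂)) (v₂ := rev (coef f₂))
    (fun i k => by rw [hrev, hrev]; exact (hl i k).2.2.2.symm)
    (fun i k => by rw [hrev, hrev]; exact (hr i k).2.2.2.symm)
    (fun i k => (hl i k).2.2.1.symm) (fun i k => (hr i k).2.2.1.symm)
  -- Exchanging `P₊` and `P₋` turns the blocks mapping into `H²` into those mapping into `H²ᗮ`.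
  simp only [← entry_reflect] at hdown
  rw [gsio_comm_iff, upCross, upCross, downCross, downCross, ← hup, ← hdown]
  simp only [hat_gsio_gsio]
  constructor
  · intro h
    refine ⟨⟨fun j k => ?_, fun j k => ?_⟩, fun j k => ?_, fun j k => ?_⟩
    · simpa only [if_pos (Int.natCast_nonneg _)] using h j k
    · simpa only [if_pos (Int.natCast_nonneg _), if_neg (show ¬(0 : ℤ) ≤ -(k + 1) by omega)]
        using h j (-(k + 1))
    · simpa only [if_neg (show ¬(0 : ℤ) ≤ -1 - j by omega),
        if_neg (show ¬(0 : ℤ) ≤ -1 - k by omega)] using h (-1 - j) (-1 - k)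
    · simpa only [if_neg (show ¬(0 : ℤ) ≤ -1 - j by omega),
        if_pos (show (0 : ℤ) ≤ -1 - -(k + 1) by omega)] using h (-1 - j) (-1 - -(k + 1))
  · rintro ⟨⟨h1, h2⟩, h3, h4⟩ j k
    rcases lt_or_ge j 0 with hj | hj <;> rcases lt_or_ge k 0 with hk | hk
    · obtain ⟨j, rfl⟩ : ∃ n : ℕ, j = -1 - n := ⟨(-1 - j).toNat, by omega⟩
      obtain ⟨k, rfl⟩ : ∃ n : ℕ, k = -1 - n := ⟨(-1 - k).toNat, by omega⟩
      simpa only [if_neg hj.not_ge, if_neg hk.not_ge] using h3 j k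
    · obtain ⟨j, rfl⟩ : ∃ n : ℕ, j = -1 - n := ⟨(-1 - j).toNat, by omega⟩
      obtain ⟨k, rfl⟩ : ∃ n : ℕ, k = -1 - -(n + 1) := ⟨k.toNat, by omega⟩
      simpa only [if_neg hj.not_ge, if_pos hk] using h4 j k
    · obtain ⟨j, rfl⟩ := Int.eq_ofNat_of_zero_le hj
      obtain ⟨k, rfl⟩ : ∃ n : ℕ, k = -(n + 1) := ⟨(-k - 1).toNat, by omega⟩
      simpa only [if_pos hj, if_neg hk.not_ge] using h2 j k
    · obtain ⟨j, rfl⟩ := Int.eq_ofNat_of_zero_le hj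
      obtain ⟨k, rfl⟩ := Int.eq_ofNat_of_zero_le hk
      simpa only [if_pos hj, if_pos hk] using h1 j k

/-! ### Equality of two rank-one kernels -/

/-- Two rank-one kernels agree if both vanish or their factors are proportional. -/
theorem rankOne_eq_cases {ι κ : Type*} {a c : ι → ℂ} {b d : κ → ℂ}
    (h : ∀ i k, a i * b k = c i * d k) :
    (a = 0 ∧ c = 0) ∨ (a = 0 ∧ d = 0) ∨ (b = 0 ∧ c = 0) ∨ (b = 0 ∧ d = 0) ∨
      (a ≠ 0 ∧ b ≠ 0 ∧ ∃ l : ℂ, l ≠ 0 ∧ a = l • c ∧ d = l • b) := by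
  by_cases hab : a = 0 ∨ b = 0
  · have hcd : c = 0 ∨ d = 0 := by
      by_contra! hcd
      obtain ⟨i, hi⟩ := Function.ne_iff.1 hcd.1
      obtain ⟨k, hk⟩ := Function.ne_iff.1 hcd.2
      refine mul_ne_zero hi hk ?_
      rw [← h i k]
      rcases hab with rfl | rfl <;> simp
    tauto
  · push Not at hab
    obtain ⟨i, hi⟩ := Function.ne_iff.1 hab.1
    obtain ⟨k, hk⟩ := Function.ne_iff.1 hab.2
    simp only [Pi.zero_apply] at hi hk
    have hne : c i * d k ≠ 0 := h i k ▸ mul_ne_zero hi hk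
    have hc := left_ne_zero_of_mul hne
    have hd := right_ne_zero_of_mul hne
    refine Or.inr (Or.inr (Or.inr (Or.inr ⟨hab.1, hab.2, d k / b k, div_ne_zero hd hk, ?_, ?_⟩)))
    · ext i'
      rw [Pi.smul_apply, smul_eq_mul, div_mul_eq_mul_div, eq_div_iff hk, h, mul_comm]
    · ext k'
      rw [Pi.smul_apply, smul_eq_mul, div_mul_eq_mul_div, eq_div_iff hk]
      apply mul_left_cancel₀ hc
      linear_combination b k' * h i k - b k * h i k'

theorem sumElim_eq_smul {α β : Type*} {a c : α → ℂ} {b d : β → ℂ} {l : ℂ} :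
    Sum.elim a b = l • Sum.elim c d ↔ a = l • c ∧ b = l • d := by
  simp [funext_iff, Sum.forall]

theorem sumElim_eq_zero {α β : Type*} {a : α → ℂ} {b : β → ℂ} :
    Sum.elim a b = 0 ↔ a = 0 ∧ b = 0 := by
  simp [funext_iff, Sum.forall]

/-- The possible shapes of a solution of `tensorSide H₁ H₂ = 0`. -/
theorem tensorSide_cases {f₁ u₁ g₁ v₁ f₂ u₂ g₂ v₂ : LInf}
    (h : tensorSide !![f₁, u₁; g₁, v₁] !![f₂, u₂; g₂, v₂] = 0) :
    ((up f₁ = 0 ∧ down g₁ = 0) ∧ up u₁ = 0 ∧ down v₁ = 0) ∨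
    ((up f₁ = 0 ∧ down g₁ = 0) ∧ down g₂ = 0 ∧ up v₂ = 0) ∨
    ((down f₂ = 0 ∧ up u₂ = 0) ∧ up u₁ = 0 ∧ down v₁ = 0) ∨
    ((down f₂ = 0 ∧ up u₂ = 0) ∧ down g₂ = 0 ∧ up v₂ = 0) ∨
    (¬(up f₁ = 0 ∧ down g₁ = 0) ∧ ¬(down f₂ = 0 ∧ up u₂ = 0) ∧ ∃ l : ℂ, l ≠ 0 ∧
      (up f₁ = l • up u₁ ∧ down g₁ = l • down v₁) ∧
        down g₂ = l • down f₂ ∧ up v₂ = l • up u₂) := by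
  have hk : ∀ i k, Sum.elim (up f₁) (down g₁) i * Sum.elim (down f₂) (up u₂) k
      = Sum.elim (up u₁) (down v₁) i * Sum.elim (down g₂) (up v₂) k := by
    rintro (i | i) (k | k)
    exacts [(tensorSide_eq_zero h i k).1, (tensorSide_eq_zero h i k).2.1,
      (tensorSide_eq_zero h i k).2.2.1, (tensorSide_eq_zero h i k).2.2.2]
  simpa only [sumElim_eq_zero, sumElim_eq_smul, ne_eq] using rankOne_eq_cases hk

theorem up_sub_smul_eq_zero {f u : LInf} {l : ℂ} : up (f - l • u) = 0 ↔ up f = l • up u := by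
  rw [map_sub, map_smul, sub_eq_zero]

theorem down_sub_smul_eq_zero {f u : LInf} {l : ℂ} :
    down (f - l • u) = 0 ↔ down f = l • down u := by
  rw [map_sub, map_smul, sub_eq_zero]

end GCSI

end

/-! ### The commutation criterion -/

theorem theorem4p3 (f₁ u₁ g₁ v₁ f₂ u₂ g₂ v₂ : LInf)
    (hleft : tensorSide !![f₁, u₁; g₁, v₁] !![f₂, u₂; g₂, v₂] = 0)
    (hright : tensorSide !![f₂, u₂; g₂, v₂] !![f₁, u₁; g₁, v₁] = 0) :
    gsio !![f₁, u₁; g₁, v₁] ∘L gsio !![f₂, u₂; g₂, v₂]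
        = gsio !![f₂, u₂; g₂, v₂] ∘L gsio !![f₁, u₁; g₁, v₁] ↔
      -- (1)
      (star f₁ ∈ HInf ∧ star f₂ ∈ HInf ∧ g₁ ∈ HInf ∧ g₂ ∈ HInf ∧
        star u₁ ∈ HInf ∧ star u₂ ∈ HInf ∧ v₁ ∈ HInf ∧ v₂ ∈ HInf) ∨
      -- (2)
      (star f₁ ∈ HInf ∧ star f₂ ∈ HInf ∧ g₁ ∈ HInf ∧ g₂ ∈ HInf ∧ star u₂ ∈ HInf ∧
        (star f₂ - star v₂) * star u₁ ∈ HInf ∧ IsConst v₂) ∨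
      -- (2^)
      (star f₁ ∈ HInf ∧ star f₂ ∈ HInf ∧ g₁ ∈ HInf ∧ g₂ ∈ HInf ∧ star u₁ ∈ HInf ∧
        (star f₁ - star v₁) * star u₂ ∈ HInf ∧ IsConst v₁) ∨
      -- (3)
      (g₂ ∈ HInf ∧ star u₁ ∈ HInf ∧ star u₂ ∈ HInf ∧ v₁ ∈ HInf ∧ v₂ ∈ HInf ∧
        (f₂ - v₂) * g₁ ∈ HInf ∧ IsConst f₂) ∨
      -- (3^)
      (g₁ ∈ HInf ∧ star u₁ ∈ HInf ∧ star u₂ ∈ HInf ∧ v₁ ∈ HInf ∧ v₂ ∈ HInf ∧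
        (f₁ - v₁) * g₂ ∈ HInf ∧ IsConst f₁) ∨
      -- (4)
      (g₂ ∈ HInf ∧ star u₂ ∈ HInf ∧ (star f₂ - star v₂) * star u₁ ∈ HInf ∧
        (f₂ - v₂) * g₁ ∈ HInf ∧ IsConst f₂ ∧ IsConst v₂) ∨
      -- (4^)
      (g₁ ∈ HInf ∧ star u₁ ∈ HInf ∧ (star f₁ - star v₁) * star u₂ ∈ HInf ∧
        (f₁ - v₁) * g₂ ∈ HInf ∧ IsConst f₁ ∧ IsConst v₁) ∨
      -- (5)
      (star f₁ ∈ HInf ∧ star f₂ ∈ HInf ∧ g₁ ∈ HInf ∧ g₂ ∈ HInf ∧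
        star v₁ ∈ HInf ∧ star v₂ ∈ HInf ∧
        (star f₁ - star v₁) * star u₂ - (star f₂ - star v₂) * star u₁ ∈ HInf) ∨
      -- (6)
      (g₁ ∈ HInf ∧ g₂ ∈ HInf ∧ star u₁ ∈ HInf ∧ star u₂ ∈ HInf ∧ IsConst f₂ ∧ IsConst v₁) ∨
      -- (6^)
      (g₁ ∈ HInf ∧ g₂ ∈ HInf ∧ star u₁ ∈ HInf ∧ star u₂ ∈ HInf ∧ IsConst f₁ ∧ IsConst v₂) ∨
      -- (7)
      (g₁ ∈ HInf ∧ g₂ ∈ HInf ∧ star u₂ ∈ HInf ∧ star v₁ ∈ HInf ∧ star v₂ ∈ HInf ∧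
        (star f₂ - star v₂) * star u₁ ∈ HInf ∧ IsConst f₂) ∨
      -- (7^)
      (g₁ ∈ HInf ∧ g₂ ∈ HInf ∧ star u₁ ∈ HInf ∧ star v₁ ∈ HInf ∧ star v₂ ∈ HInf ∧
        (star f₁ - star v₁) * star u₂ ∈ HInf ∧ IsConst f₁) ∨
      -- (8)
      (∃ l : ℂ, l ≠ 0 ∧ g₁ ∈ HInf ∧ g₂ ∈ HInf ∧ star f₁ - star l • star u₁ ∈ HInf ∧
        star v₂ - star l • star u₂ ∈ HInf ∧
        star f₁ * star f₂ + star v₁ * star v₂ - star f₁ * star v₂ ∈ HInf ∧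
        IsConst f₂ ∧ IsConst v₁) ∨
      -- (8^)
      (∃ m : ℂ, m ≠ 0 ∧ g₁ ∈ HInf ∧ g₂ ∈ HInf ∧ star f₂ - star m • star u₂ ∈ HInf ∧
        star v₁ - star m • star u₁ ∈ HInf ∧
        star f₁ * star f₂ + star v₁ * star v₂ - star f₂ * star v₁ ∈ HInf ∧
        IsConst f₁ ∧ IsConst v₂) ∨
      -- (9)
      (f₁ ∈ HInf ∧ f₂ ∈ HInf ∧ star u₁ ∈ HInf ∧ star u₂ ∈ HInf ∧ v₁ ∈ HInf ∧ v₂ ∈ HInf ∧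
        (f₂ - v₂) * g₁ - (f₁ - v₁) * g₂ ∈ HInf) ∨
      -- (10)
      (f₁ ∈ HInf ∧ f₂ ∈ HInf ∧ g₂ ∈ HInf ∧ star u₁ ∈ HInf ∧ star u₂ ∈ HInf ∧
        (f₂ - v₂) * g₁ ∈ HInf ∧ IsConst v₂) ∨
      -- (10^)
      (f₁ ∈ HInf ∧ f₂ ∈ HInf ∧ g₁ ∈ HInf ∧ star u₁ ∈ HInf ∧ star u₂ ∈ HInf ∧
        (f₁ - v₁) * g₂ ∈ HInf ∧ IsConst v₁) ∨
      -- (11)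
      (∃ l : ℂ, l ≠ 0 ∧ star u₁ ∈ HInf ∧ star u₂ ∈ HInf ∧ g₁ - l • v₁ ∈ HInf ∧
        g₂ - l • f₂ ∈ HInf ∧ f₁ * f₂ + v₁ * v₂ - v₁ * f₂ ∈ HInf ∧
        IsConst f₁ ∧ IsConst v₂) ∨
      -- (11^)
      (∃ m : ℂ, m ≠ 0 ∧ star u₁ ∈ HInf ∧ star u₂ ∈ HInf ∧ g₂ - m • v₂ ∈ HInf ∧
        g₁ - m • f₁ ∈ HInf ∧ f₁ * f₂ + v₁ * v₂ - v₂ * f₁ ∈ HInf ∧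
        IsConst f₂ ∧ IsConst v₁) ∨
      -- (12)
      (f₁ ∈ HInf ∧ f₂ ∈ HInf ∧ g₁ ∈ HInf ∧ g₂ ∈ HInf ∧ star u₁ ∈ HInf ∧ star u₂ ∈ HInf ∧
        star v₁ ∈ HInf ∧ star v₂ ∈ HInf) ∨
      -- (13)
      (∃ l m : ℂ, l ≠ 0 ∧ m ≠ 0 ∧
        star f₁ - star l • star u₁ ∈ HInf ∧ g₁ - l • v₁ ∈ HInf ∧
        g₂ - l • f₂ ∈ HInf ∧ star v₂ - star l • star u₂ ∈ HInf ∧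
        star f₂ - star m • star u₂ ∈ HInf ∧ g₂ - m • v₂ ∈ HInf ∧
        g₁ - m • f₁ ∈ HInf ∧ star v₁ - star m • star u₁ ∈ HInf ∧
        IsConst (l • (f₂ * v₁) - m • (f₁ * v₂))) := by
  rw [gsio_comm_iff_cross hleft hright]
  simp only [← LInf.star_sub, ← LInf.star_smul, ← LInf.star_mul, ← LInf.star_add,
    star_mem_HInf_iff]
  simp only [mem_HInf_iff, isConst_iff]
  constructor
  -- Hypotheses are named after the coefficients they concern: `uf₁` is about `up f₁`, `dg₂` about
  -- `down g₂`, and so on.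
  · rintro ⟨hX, hY⟩
    rcases tensorSide_cases hleft with ⟨⟨uf₁, dg₁⟩, uu₁, dv₁⟩ | ⟨⟨uf₁, dg₁⟩, dg₂, uv₂⟩ |
      ⟨⟨df₂, uu₂⟩, uu₁, dv₁⟩ | ⟨⟨df₂, uu₂⟩, dg₂, uv₂⟩ |
      ⟨hne, hne', l, hl, ⟨uf₁, dg₁⟩, dg₂, uv₂⟩
    · rcases tensorSide_cases hright with ⟨⟨uf₂, dg₂⟩, uu₂, dv₂⟩ | ⟨⟨uf₂, dg₂⟩, -, uv₁⟩ |
        ⟨⟨df₁, -⟩, uu₂, dv₂⟩ | ⟨⟨df₁, -⟩, -, uv₁⟩ | ⟨-, hne, m, hm, -, dg₁', -⟩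
      · left
        and_intros <;> assumption
      · rw [upCross_eq uf₁ uv₁, upCross_eq_zero uu₁] at hX
        iterate 2 right
        left
        and_intros <;> assumption
      · rw [downCross_eq df₁ dv₁, downCross_eq_zero dg₁, neg_eq_zero] at hY
        iterate 4 right
        left
        and_intros <;> assumption
      · rw [upCross_eq uf₁ uv₁, upCross_eq_zero uu₁] at hX
        rw [downCross_eq df₁ dv₁, downCross_eq_zero dg₁, neg_eq_zero] at hY
        iterate 6 right
        left
        and_intros <;> assumption
      · rw [dg₁, eq_comm, smul_eq_zero_iff_right hm] at dg₁'
        -- A vector of the proportional pattern would vanish.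
        exact absurd ⟨dg₁', uu₁⟩ hne
    · rcases tensorSide_cases hright with ⟨⟨uf₂, -⟩, uu₂, dv₂⟩ | ⟨⟨uf₂, -⟩, -, uv₁⟩ |
        ⟨⟨df₁, uu₁⟩, uu₂, dv₂⟩ | ⟨⟨df₁, uu₁⟩, -, uv₁⟩ |
        ⟨-, -, m, hm, ⟨uf₂, dg₂'⟩, dg₁', uv₁⟩
      · rw [upCross_eq uf₂ uv₂, upCross_eq_zero uu₂] at hX
        right
        left
        and_intros <;> first | assumption | exact hX.symm
      · rw [upCross_eq uf₁ uv₁, upCross_eq uf₂ uv₂, ← sub_eq_zero, ← map_sub] at hX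
        iterate 7 right
        left
        and_intros <;> assumption
      · iterate 9 right
        left
        and_intros <;> assumption
      · rw [upCross_eq uf₁ uv₁, upCross_eq_zero uu₁] at hX
        iterate 11 right
        left
        and_intros <;> assumption
      · rw [dg₂, eq_comm, smul_eq_zero_iff_right hm] at dg₂'
        rw [dg₁, eq_comm, smul_eq_zero_iff_right hm] at dg₁'
        have key := smul_upCross_sub_of_const uf₂ uv₁ uf₁ uv₂
        rw [hX, sub_self, smul_zero, eq_comm, neg_eq_zero,
          LInf.mul_comm f₂, LInf.mul_comm v₂] at key
        iterate 13 right
        left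
        refine ⟨m, hm, dg₁, dg₂, up_sub_smul_eq_zero.2 uf₂, up_sub_smul_eq_zero.2 uv₁, key, ?_⟩
        and_intros <;> assumption
    · rcases tensorSide_cases hright with ⟨⟨uf₂, dg₂⟩, -, dv₂⟩ | ⟨⟨uf₂, dg₂⟩, dg₁, uv₁⟩ |
        ⟨⟨df₁, -⟩, -, dv₂⟩ | ⟨⟨df₁, -⟩, dg₁, uv₁⟩ |
        ⟨-, -, m, hm, ⟨uf₂, dg₂⟩, dg₁, uv₁⟩
      · rw [downCross_eq df₂ dv₂, downCross_eq_zero dg₂, zero_eq_neg] at hY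
        iterate 3 right
        left
        and_intros <;> assumption
      · iterate 8 right
        left
        and_intros <;> assumption
      · rw [downCross_eq df₁ dv₁, downCross_eq df₂ dv₂, neg_inj, eq_comm, ← sub_eq_zero,
          ← map_sub] at hY
        iterate 14 right
        left
        and_intros <;> assumption
      · rw [downCross_eq df₁ dv₁, downCross_eq_zero dg₁, neg_eq_zero] at hY
        iterate 16 right
        left
        and_intros <;> assumption
      · rw [uu₂, smul_zero] at uf₂
        rw [uu₁, smul_zero] at uv₁
        have key := smul_downCross_sub_of_const hm dg₂ dg₁ dv₁ df₂
        rw [hY, sub_self, smul_zero, eq_comm, neg_eq_zero,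
          LInf.mul_comm f₂, LInf.mul_comm v₂] at key
        iterate 18 right
        left
        refine ⟨m, hm, uu₁, uu₂, down_sub_smul_eq_zero.2 dg₂, down_sub_smul_eq_zero.2 dg₁, key, ?_⟩
        and_intros <;> assumption
    · rcases tensorSide_cases hright with ⟨⟨uf₂, -⟩, -, dv₂⟩ | ⟨⟨uf₂, -⟩, dg₁, uv₁⟩ |
        ⟨⟨df₁, uu₁⟩, -, dv₂⟩ | ⟨⟨df₁, uu₁⟩, dg₁, uv₁⟩ | ⟨hne, -, m, hm, ⟨uf₂, -⟩, -⟩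
      · rw [upCross_eq uf₂ uv₂, upCross_eq_zero uu₂] at hX
        rw [downCross_eq df₂ dv₂, downCross_eq_zero dg₂, zero_eq_neg] at hY
        iterate 5 right
        left
        and_intros <;> first | assumption | exact hX.symm
      · rw [upCross_eq uf₂ uv₂, upCross_eq_zero uu₂] at hX
        iterate 10 right
        left
        and_intros <;> first | assumption | exact hX.symm
      · rw [downCross_eq df₂ dv₂, downCross_eq_zero dg₂, zero_eq_neg] at hY
        iterate 15 right
        left
        and_intros <;> assumption
      · iterate 19 right
        left
        and_intros <;> assumption
      · rw [uu₂, smul_zero] at uf₂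
        -- A vector of the proportional pattern would vanish.
        exact absurd ⟨uf₂, dg₂⟩ hne
    · rcases tensorSide_cases hright with ⟨⟨-, dg₂'⟩, uu₂, -⟩ | ⟨⟨uf₂, dg₂'⟩, dg₁', uv₁⟩ |
        ⟨⟨df₁, uu₁⟩, uu₂, dv₂⟩ | ⟨⟨-, uu₁⟩, dg₁', -⟩ |
        ⟨-, -, m, hm, ⟨uf₂, dg₂'⟩, dg₁', uv₁⟩
      · rw [dg₂', eq_comm, smul_eq_zero_iff_right hl] at dg₂
        -- A vector of the proportional pattern would vanish.
        exact absurd ⟨dg₂, uu₂⟩ hne'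
      · rw [dg₂', eq_comm, smul_eq_zero_iff_right hl] at dg₂
        rw [dg₁', eq_comm, smul_eq_zero_iff_right hl] at dg₁
        have key := smul_upCross_sub_of_const uf₁ uv₂ uf₂ uv₁
        rw [hX, sub_self, smul_zero, eq_comm, neg_eq_zero] at key
        iterate 12 right
        left
        refine ⟨l, hl, dg₁', dg₂', up_sub_smul_eq_zero.2 uf₁, up_sub_smul_eq_zero.2 uv₂, key, ?_⟩
        and_intros <;> assumption
      · rw [uu₁, smul_zero] at uf₁
        rw [uu₂, smul_zero] at uv₂
        have key := smul_downCross_sub_of_const hl dg₁ dg₂ dv₂ df₁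
        rw [hY, sub_self, smul_zero, eq_comm, neg_eq_zero] at key
        iterate 17 right
        left
        refine ⟨l, hl, uu₁, uu₂, down_sub_smul_eq_zero.2 dg₁, down_sub_smul_eq_zero.2 dg₂, key, ?_⟩
        and_intros <;> assumption
      · rw [uu₁, smul_zero] at uf₁
        -- A vector of the proportional pattern would vanish.
        exact absurd ⟨uf₁, dg₁'⟩ hne
      · have keyup := smul_upCross_sub uf₁ uv₂ uf₂ uv₁
        rw [hX, sub_self, smul_zero, eq_comm, neg_eq_zero] at keyup
        have keydown := downCross_sub hl hm dg₁ dg₂ dg₂' dg₁'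
        rw [hY, sub_self, eq_comm] at keydown
        iterate 20 right
        exact ⟨l, m, hl, hm, up_sub_smul_eq_zero.2 uf₁, down_sub_smul_eq_zero.2 dg₁,
          down_sub_smul_eq_zero.2 dg₂, up_sub_smul_eq_zero.2 uv₂, up_sub_smul_eq_zero.2 uf₂,
          down_sub_smul_eq_zero.2 dg₂', down_sub_smul_eq_zero.2 dg₁',
          up_sub_smul_eq_zero.2 uv₁, keyup, keydown⟩
  · rintro (⟨-, -, dg₁, dg₂, uu₁, uu₂, -, -⟩ | ⟨-, uf₂, dg₁, dg₂, uu₂, h, uv₂, -⟩ |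
      ⟨uf₁, -, dg₁, dg₂, uu₁, h, uv₁, -⟩ | ⟨dg₂, uu₁, uu₂, -, dv₂, h, -, df₂⟩ |
      ⟨dg₁, uu₁, uu₂, dv₁, -, h, -, df₁⟩ | ⟨dg₂, uu₂, h, h', ⟨uf₂, df₂⟩, uv₂, dv₂⟩ |
      ⟨dg₁, uu₁, h, h', ⟨uf₁, df₁⟩, uv₁, dv₁⟩ | ⟨uf₁, uf₂, dg₁, dg₂, uv₁, uv₂, h⟩ |
      ⟨dg₁, dg₂, uu₁, uu₂, -⟩ | ⟨dg₁, dg₂, uu₁, uu₂, -⟩ | ⟨dg₁, dg₂, uu₂, -, uv₂, h, uf₂, -⟩ |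
      ⟨dg₁, dg₂, uu₁, uv₁, -, h, uf₁, -⟩ | ⟨l, hl, dg₁, dg₂, uf₁, uv₂, h, ⟨uf₂, -⟩, uv₁, -⟩ |
      ⟨m, hm, dg₁, dg₂, uf₂, uv₁, h, ⟨uf₁, -⟩, uv₂, -⟩ | ⟨df₁, df₂, uu₁, uu₂, dv₁, dv₂, h⟩ |
      ⟨-, df₂, dg₂, uu₁, uu₂, h, -, dv₂⟩ | ⟨df₁, -, dg₁, uu₁, uu₂, h, -, dv₁⟩ |
      ⟨l, hl, uu₁, uu₂, dg₁, dg₂, h, ⟨-, df₁⟩, -, dv₂⟩ |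
      ⟨m, hm, uu₁, uu₂, dg₂, dg₁, h, ⟨-, df₂⟩, -, dv₁⟩ | ⟨-, -, dg₁, dg₂, uu₁, uu₂, -, -⟩ |
      ⟨l, m, hl, hm, uf₁, dg₁, dg₂, uv₂, uf₂, dg₂', dg₁', uv₁, h, h'⟩)
    · exact ⟨by rw [upCross_eq_zero uu₁, upCross_eq_zero uu₂],
        by rw [downCross_eq_zero dg₁, downCross_eq_zero dg₂]⟩
    · exact ⟨by rw [upCross_eq_zero uu₂, upCross_eq uf₂ uv₂, h],
        by rw [downCross_eq_zero dg₁, downCross_eq_zero dg₂]⟩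
    · exact ⟨by rw [upCross_eq_zero uu₁, upCross_eq uf₁ uv₁, h],
        by rw [downCross_eq_zero dg₁, downCross_eq_zero dg₂]⟩
    · exact ⟨by rw [upCross_eq_zero uu₁, upCross_eq_zero uu₂],
        by rw [downCross_eq_zero dg₂, downCross_eq df₂ dv₂, h, neg_zero]⟩
    · exact ⟨by rw [upCross_eq_zero uu₁, upCross_eq_zero uu₂],
        by rw [downCross_eq_zero dg₁, downCross_eq df₁ dv₁, h, neg_zero]⟩
    · exact ⟨by rw [upCross_eq_zero uu₂, upCross_eq uf₂ uv₂, h],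
        by rw [downCross_eq_zero dg₂, downCross_eq df₂ dv₂, h', neg_zero]⟩
    · exact ⟨by rw [upCross_eq_zero uu₁, upCross_eq uf₁ uv₁, h],
        by rw [downCross_eq_zero dg₁, downCross_eq df₁ dv₁, h', neg_zero]⟩
    · refine ⟨?_, by rw [downCross_eq_zero dg₁, downCross_eq_zero dg₂]⟩
      rw [upCross_eq uf₁ uv₁, upCross_eq uf₂ uv₂, ← sub_eq_zero, ← map_sub, h]
    · exact ⟨by rw [upCross_eq_zero uu₁, upCross_eq_zero uu₂],
        by rw [downCross_eq_zero dg₁, downCross_eq_zero dg₂]⟩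
    · exact ⟨by rw [upCross_eq_zero uu₁, upCross_eq_zero uu₂],
        by rw [downCross_eq_zero dg₁, downCross_eq_zero dg₂]⟩
    · exact ⟨by rw [upCross_eq_zero uu₂, upCross_eq uf₂ uv₂, h],
        by rw [downCross_eq_zero dg₁, downCross_eq_zero dg₂]⟩
    · exact ⟨by rw [upCross_eq_zero uu₁, upCross_eq uf₁ uv₁, h],
        by rw [downCross_eq_zero dg₁, downCross_eq_zero dg₂]⟩
    · refine ⟨?_, by rw [downCross_eq_zero dg₁, downCross_eq_zero dg₂]⟩
      rw [← sub_eq_zero, ← smul_eq_zero_iff_right hl, smul_upCross_sub_of_const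
        (up_sub_smul_eq_zero.1 uf₁) (up_sub_smul_eq_zero.1 uv₂) uf₂ uv₁, h, neg_zero]
    · refine ⟨?_, by rw [downCross_eq_zero dg₁, downCross_eq_zero dg₂]⟩
      rw [eq_comm, ← sub_eq_zero, ← smul_eq_zero_iff_right hm, smul_upCross_sub_of_const
        (up_sub_smul_eq_zero.1 uf₂) (up_sub_smul_eq_zero.1 uv₁) uf₁ uv₂, neg_eq_zero,
          LInf.mul_comm f₂, LInf.mul_comm v₂, h]
    · refine ⟨by rw [upCross_eq_zero uu₁, upCross_eq_zero uu₂], ?_⟩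
      rw [downCross_eq df₁ dv₁, downCross_eq df₂ dv₂, neg_inj, eq_comm, ← sub_eq_zero,
        ← map_sub, h]
    · exact ⟨by rw [upCross_eq_zero uu₁, upCross_eq_zero uu₂],
        by rw [downCross_eq_zero dg₂, downCross_eq df₂ dv₂, h, neg_zero]⟩
    · exact ⟨by rw [upCross_eq_zero uu₁, upCross_eq_zero uu₂],
        by rw [downCross_eq_zero dg₁, downCross_eq df₁ dv₁, h, neg_zero]⟩
    · refine ⟨by rw [upCross_eq_zero uu₁, upCross_eq_zero uu₂], ?_⟩
      rw [← sub_eq_zero, ← smul_eq_zero_iff_right (inv_ne_zero hl), smul_downCross_sub_of_const hl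
        (down_sub_smul_eq_zero.1 dg₁) (down_sub_smul_eq_zero.1 dg₂) dv₂ df₁, h, neg_zero]
    · refine ⟨by rw [upCross_eq_zero uu₁, upCross_eq_zero uu₂], ?_⟩
      rw [eq_comm, ← sub_eq_zero, ← smul_eq_zero_iff_right (inv_ne_zero hm),
        smul_downCross_sub_of_const hm (down_sub_smul_eq_zero.1 dg₂)
        (down_sub_smul_eq_zero.1 dg₁) dv₁ df₂, neg_eq_zero,
          LInf.mul_comm f₂, LInf.mul_comm v₂, h]
    · exact ⟨by rw [upCross_eq_zero uu₁, upCross_eq_zero uu₂],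
        by rw [downCross_eq_zero dg₁, downCross_eq_zero dg₂]⟩
    · constructor
      · rw [← sub_eq_zero, ← smul_eq_zero_iff_right (mul_ne_zero hl hm), smul_upCross_sub
          (up_sub_smul_eq_zero.1 uf₁) (up_sub_smul_eq_zero.1 uv₂) (up_sub_smul_eq_zero.1 uf₂)
          (up_sub_smul_eq_zero.1 uv₁), h, neg_zero]
      · rw [← sub_eq_zero, downCross_sub hl hm (down_sub_smul_eq_zero.1 dg₁)
          (down_sub_smul_eq_zero.1 dg₂) (down_sub_smul_eq_zero.1 dg₂')
          (down_sub_smul_eq_zero.1 dg₁'), h']
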